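/- A topological space $X$ is called - *strongly rigid* if every continuous map $X\to X$ other than the identity is constant; - *semi-Hausdorff* if for any distinct $x,y\in X$ there is a regular open set $U\subseteq X$ (that is, $U$ equals the interior of its closure) with $x\in U$ and $y\notin U$; - *Brown* if $\overline U\cap\overline V$ is infinite for any nonempty open sets $U,V\subseteq X$; - *$k_2$-metrizable* if there is a continuous bijection $f:M\to X$ from a metrizable space $M$ onto $X$ such that $f^{-1}[K]$ is compact for every compact set $K\subseteq X$, and such that for every continuous map $g:K\to X$ from a compact Hausdorff space $K$ the map $f^{-1}\circ g:K\to M$ is continuous; - *$k_\Delta$-Hausdorff* if for every continuous map $f:K\to X\times X$ from a compact Hausdorff space $K$ the preimage $f^{-1}[\Delta_X]$ of the diagonal $\Delta_X=\{(x,x):x\in X\}$ is closed in $K$; - a *US-space* if every convergent sequence in $X$ has a unique limit. A set $A\subseteq X$ is a *retract* of $X$ if there is a continuous map $r:X\to A$ with $r(a)=a$ for all $a\in A$. **Theorem.** There exists a countable topological space $X$ that is strongly rigid, $k_2$-metrizable, semi-Hausdorff and Brown, and that contains a compact metrizable subspace which is not closed in $X$. Moreover, every retract of $X$ is closed in $X$,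 and $X$ is a $k_\Delta$-Hausdorff US-space. -/

import Mathlib

open Set Filter Topology

universe u v

/-- Every continuous self-map other than the identity is constant. -/
def StronglyRigid (X : Type u) [TopologicalSpace X] : Prop :=
  ∀ f : X → X, Continuous f → f ≠ id → ∃ c : X, ∀ x : X, f x = c

/-- A set that coincides with the interior of its closure. -/
def IsRegularOpenSet {X : Type u} [TopologicalSpace X] (U : Set X) : Prop :=
  interior (closure U) = U

/-- For distinct points `x`, `y` some regular open set contains `x` but not `y`. -/
def SemiHausdorff (X : Type u) [TopologicalSpace X] : Prop :=
  ∀ x y : X, x ≠ y → ∃ U : Set X, IsRegularOpenSet U ∧ x ∈ U ∧ y ∉ U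

/-- The closures of any two nonempty open sets have infinite intersection. -/
def Brown (X : Type u) [TopologicalSpace X] : Prop :=
  ∀ U V : Set X, IsOpen U → IsOpen V → U.Nonempty → V.Nonempty →
    (closure U ∩ closure V).Infinite

/-- A continuous function under which the preimage of every compact set is compact
(the compact sets are not required to be closed). -/
def ProperFunction {X : Type u} {Y : Type v} [TopologicalSpace X] [TopologicalSpace Y]
    (f : X → Y) : Prop :=
  Continuous f ∧ ∀ K : Set Y, IsCompact K → IsCompact (f ⁻¹' K)

/-- There is a continuous proper bijection `f` from a metrizable space `M` onto `X` such that
`f⁻¹ ∘ g` is continuous for every continuous map `g : K → X` from a compact Hausdorff space `K`.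
The spaces `K` range over a universe `v` independent of that of `X`. -/
def K2Metrizable (X : Type u) [TopologicalSpace X] : Prop :=
  ∃ (M : Type u) (_ : TopologicalSpace M) (f : M ≃ X),
    TopologicalSpace.MetrizableSpace M ∧ ProperFunction f ∧
      ∀ (K : Type v) [TopologicalSpace K] [CompactSpace K] [T2Space K] (g : K → X),
        Continuous g → Continuous (fun k => f.symm (g k))

/-- The preimage of the diagonal of `X × X` under every continuous map from a compact Hausdorff
space `K` is closed in `K`. The spaces `K` range over a universe `v` independent of that of `X`. -/
def KDeltaHausdorff (X : Type u) [TopologicalSpace X] : Prop :=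
  ∀ (K : Type v) [TopologicalSpace K] [CompactSpace K] [T2Space K] (f : K → X × X),
    Continuous f → IsClosed (f ⁻¹' diagonal X)

/-- Every convergent sequence has a unique limit. -/
def USSpace (X : Type u) [TopologicalSpace X] : Prop :=
  ∀ (s : ℕ → X) (a b : X), Tendsto s atTop (𝓝 a) → Tendsto s atTop (𝓝 b) → a = b

/-- There is a continuous map `X → A` that fixes every point of `A`. -/
def IsRetractOf {X : Type u} [TopologicalSpace X] (A : Set X) : Prop :=
  ∃ f : X → A, Continuous f ∧ ∀ a : A, f a = a

/-! The space consists of the vertices of an infinitely branching tree, a link for each pair of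
distinct vertices, and a hub. The children of a vertex are arranged in finite grids. A set is open
when its complement is negligible at each of its points: at a vertex it may meet the columns of the
vertex's grids in few points, at a link the rows of the grids of both ends reserved for that link,
and at the hub it may contain finitely many points of `hubSeq`. Few means at most `width k ^ r` with
one `r` for all blocks, while full blocks have `width k ^ (k + 2)` points.

Brown: rows and columns of a grid cross, so by counting, a link lies in the closure of every open
set containing one of its ends (`link_mem_closure`). Semi-Hausdorff: cones of the tree are nested or
disjoint, and different points have essentially different nearby children.

Rigidity: if `f x ≠ x` and `f x` is not the hub, then `f` equals `f x` near `x` up to a negligible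
set. Otherwise `exists_subset_image_thin` finds a non-negligible set whose image is closed after
adding points other than `f x`, against continuity. So a fiber without finitely many points is open;
when it is nonempty, the Brown property forces `f` to be constant. Values at the hub need a separate
argument.

Compactness: every infinite set has an infinite thin subset, so compact sets are finite up to
`hubSeq` and the hub. They therefore behave as in the metrizable refinement where only the hub is
not isolated. -/

/-! ### Growth rates and block systems -/

/-- The scale below which a subset of a block of the `k`-th group counts as small. -/
def width : ℕ → ℕ
  | 0 => 2
  | k + 1 => width k ^ (k + 3)

/-- The size of the blocks of the `k`-th group. -/
def blockSize (k : ℕ) : ℕ := width k ^ (k + 2)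

theorem width_succ (k : ℕ) : width (k + 1) = width k * blockSize k := by
  rw [width, blockSize, ← pow_succ']

theorem add_two_le_width (k : ℕ) : k + 2 ≤ width k := by
  induction k with
  | zero => simp [width]
  | succ k ih =>
    have h1 : width k ^ 2 ≤ width k ^ (k + 3) := Nat.pow_le_pow_right (by omega) (by omega)
    rw [width]
    nlinarith

theorem two_le_width (k : ℕ) : 2 ≤ width k := le_trans (by omega) (add_two_le_width k)

theorem one_le_width (k : ℕ) : 1 ≤ width k := le_trans (by omega) (add_two_le_width k)

theorem blockSize_pos (k : ℕ) : 0 < blockSize k := Nat.pow_pos (one_le_width k)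

theorem width_mono : Monotone width :=
  monotone_nat_of_le_succ fun k => by
    rw [width_succ]; exact Nat.le_mul_of_pos_right _ (blockSize_pos k)

theorem blockSize_le_width {j k : ℕ} (h : j < k) : blockSize j ≤ width k :=
  le_trans (by rw [width_succ]; exact Nat.le_mul_of_pos_left _ (one_le_width j)) (width_mono h)

/-- Bounds the number of colour vectors over all earlier groups, so that a pigeonhole over them
costs a single factor `width k`. -/
theorem prod_blockSize_le_width (k : ℕ) : ∏ j : Fin k, blockSize j ≤ width k := by
  induction k with
  | zero => simp [width]
  | succ k ih =>
    rw [Fin.prod_univ_castSucc, width_succ]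
    exact Nat.mul_le_mul_right _ ih

theorem width_pow_lt_blockSize {k r : ℕ} (h : r < k + 2) : width k ^ r < blockSize k :=
  Nat.pow_lt_pow_right (two_le_width k) h

theorem le_width_pow (k r : ℕ) : r ≤ width k ^ r :=
  (Nat.lt_pow_self (two_le_width k)).le

/-- Finite sets (blocks), arranged in finite groups. A group may be owned by a point, and
the blocks of the `k`-th group are coloured injectively with `blockSize k` colours. -/
structure BlockSystem (X : Type*) where
  block : ℕ → ℕ → Finset X
  owner : ℕ → X → Prop
  color : ℕ → X → ℕ
  owner_unique : ∀ k x y, owner k x → owner k y → x = y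
  color_lt : ∀ k p, color k p < blockSize k
  color_injOn : ∀ k t, Set.InjOn (color k) (block k t)
  finite_group : ∀ k, (⋃ t, (block k t : Set X)).Finite

namespace BlockSystem

variable {X : Type*} (S : BlockSystem X)

theorem card_block_le (k t : ℕ) : (S.block k t).card ≤ blockSize k := by
  have := Finset.card_le_card_of_injOn (s := S.block k t) (t := Finset.range (blockSize k))
    (S.color k) (fun p _ => by simpa using S.color_lt k p) (S.color_injOn k t)
  simpa using this

open scoped Classical in
/-- The number of points of a block in a given set. -/
noncomputable def count (k t : ℕ) (E : Set X) : ℕ := ((S.block k t).filter (· ∈ E)).card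

open scoped Classical in
theorem count_mono (k t : ℕ) {E F : Set X} (h : E ⊆ F) : S.count k t E ≤ S.count k t F :=
  Finset.card_le_card (Finset.monotone_filter_right _ fun _ _ hp => h hp)

open scoped Classical in
theorem count_le_blockSize (k t : ℕ) (E : Set X) : S.count k t E ≤ blockSize k :=
  (Finset.card_filter_le _ _).trans (S.card_block_le k t)

theorem count_union_le (k t : ℕ) (E F : Set X) :
    S.count k t (E ∪ F) ≤ S.count k t E + S.count k t F := by
  classical
  unfold count
  refine le_trans (Finset.card_le_card ?_) (Finset.card_union_le _ _)
  intro p hp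
  simp only [Finset.mem_filter, Finset.mem_union, Set.mem_union] at hp ⊢
  tauto

theorem count_le_ncard (k t : ℕ) {E : Set X} (hE : E.Finite) : S.count k t E ≤ E.ncard := by
  classical
  rw [Set.ncard_eq_toFinset_card _ hE]
  exact Finset.card_le_card fun p hp => by simpa using (Finset.mem_filter.1 hp).2

theorem count_iUnion_le (k t m : ℕ) (E : ℕ → Set X) (b : ℕ) (hb : ∀ i < m, S.count k t (E i) ≤ b)
    (h0 : ∀ i, m ≤ i → Disjoint (E i) (S.block k t : Set X)) :
    S.count k t (⋃ i, E i) ≤ m * b := by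
  classical
  unfold count
  have : (S.block k t).filter (· ∈ ⋃ i, E i) ⊆
      (Finset.range m).biUnion fun i => (S.block k t).filter (· ∈ E i) := by
    intro p hp
    simp only [Finset.mem_filter, Set.mem_iUnion, Finset.mem_biUnion, Finset.mem_range] at hp ⊢
    obtain ⟨hp, i, hi⟩ := hp
    exact ⟨i, not_le.1 fun h => Set.disjoint_left.1 (h0 i h) hi hp, hp, hi⟩
  refine (Finset.card_le_card this).trans ?_
  refine (Finset.card_biUnion_le_card_mul _ _ b fun i hi => hb i (Finset.mem_range.1 hi)).trans ?_
  simp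

/-- A set is small at `x` if it meets the blocks owned by `x` in few points. -/
def Small (x : X) (E : Set X) : Prop :=
  ∃ r, ∀ k, S.owner k x → ∀ t, S.count k t E ≤ width k ^ r

variable {S} {x : X} {E F : Set X}

theorem Small.mono (h : S.Small x F) (hEF : E ⊆ F) : S.Small x E :=
  h.imp fun _ hr k hk t => (S.count_mono k t hEF).trans (hr k hk t)

theorem Small.union (hE : S.Small x E) (hF : S.Small x F) : S.Small x (E ∪ F) := by
  obtain ⟨r, hr⟩ := hE
  obtain ⟨s, hs⟩ := hF
  -- The extra exponent absorbs the factor 2.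
  refine ⟨max r s + 1, fun k hk t => ?_⟩
  have h1 : width k ^ r ≤ width k ^ max r s := Nat.pow_le_pow_right (one_le_width k) (le_max_left _ _)
  have h2 : width k ^ s ≤ width k ^ max r s := Nat.pow_le_pow_right (one_le_width k) (le_max_right _ _)
  have h3 : width k ^ max r s * 2 ≤ width k ^ (max r s + 1) := by
    rw [pow_succ]; exact Nat.mul_le_mul_left _ (two_le_width k)
  have := S.count_union_le k t E F
  have := hr k hk t
  have := hs k hk t
  omega

theorem small_of_finite (hE : E.Finite) : S.Small x E :=
  ⟨E.ncard, fun k _ t => (S.count_le_ncard k t hE).trans (le_width_pow k _)⟩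

theorem Small.biUnion {ι : Type*} {I : Set ι} (hI : I.Finite) {E : ι → Set X}
    (h : ∀ i ∈ I, S.Small x (E i)) : S.Small x (⋃ i ∈ I, E i) := by
  induction I, hI using Set.Finite.induction_on with
  | empty => simpa using small_of_finite Set.finite_empty
  | insert _ _ ih =>
    rw [Set.biUnion_insert]
    exact (h _ (Set.mem_insert _ _)).union (ih fun i hi => h i (Set.mem_insert_of_mem _ hi))

variable (S)

/-- The union of the groups up to the `k`-th. -/
def groupsUpTo (k : ℕ) : Set X := ⋃ j ∈ Set.Iic k, ⋃ t, (S.block j t : Set X)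

theorem finite_groupsUpTo (k : ℕ) : (S.groupsUpTo k).Finite :=
  (Set.finite_Iic k).biUnion fun j _ => S.finite_group j

theorem block_subset_groupsUpTo {j k : ℕ} (h : j ≤ k) (t : ℕ) :
    (S.block j t : Set X) ⊆ S.groupsUpTo k := fun _ hp =>
  Set.mem_biUnion (Set.mem_Iic.2 h) (Set.mem_iUnion.2 ⟨t, hp⟩)

/-! ### Extraction of thin subsets -/

/-- Every infinite set has an infinite subset that meets all blocks in few points. -/
theorem exists_infinite_thin_subset {E : Set X} (hE : E.Infinite) :
    ∃ F ⊆ E, F.Infinite ∧ ∀ k t, S.count k t F ≤ width k := by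
  classical
  -- Each chosen point carries a strictly increasing index and avoids all groups up to the earlier
  -- indices; hence a block of group `k` contains at most the first `k + 1` points.
  obtain ⟨f, hf, hr⟩ := exists_seq_of_forall_finset_exists (fun q : ℕ × X => q.2 ∈ E)
    (fun q q' => q.1 < q'.1 ∧ q.2 ≠ q'.2 ∧ q'.2 ∉ S.groupsUpTo q.1) (fun s _ => by
      have hfin : (⋃ q ∈ (s : Set (ℕ × X)), ({q.2} ∪ S.groupsUpTo q.1)).Finite :=
        s.finite_toSet.biUnion fun q _ => (Set.finite_singleton _).union (S.finite_groupsUpTo _)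
      obtain ⟨y, hyE, hy⟩ := (hE.sdiff hfin).nonempty
      simp only [Set.mem_iUnion, not_exists, Set.mem_union, not_or, Set.mem_singleton_iff] at hy
      refine ⟨(s.sup Prod.fst + 1, y), hyE, fun q hq => ⟨?_, fun h => (hy q hq).1 h.symm,
        (hy q hq).2⟩⟩
      exact Nat.lt_succ_of_le (Finset.le_sup (f := Prod.fst) hq))
  have hmono : StrictMono fun n => (f n).1 := fun m n h => (hr m n h).1
  refine ⟨Set.range fun n => (f n).2, ?_, ?_, ?_⟩
  · rintro _ ⟨n, rfl⟩; exact hf n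
  · refine Set.infinite_range_of_injective fun m n h => ?_
    by_contra hne
    rcases lt_or_gt_of_ne hne with h' | h'
    · exact (hr m n h').2.1 h
    · exact (hr n m h').2.1 h.symm
  · intro k t
    have := S.count_iUnion_le k t (k + 1) (fun n => {(f n).2}) 1
      (fun i _ => (S.count_le_ncard k t (Set.finite_singleton _)).trans (by simp))
      (fun i hi => by
        rw [Set.disjoint_singleton_left]
        exact fun h => (hr k i hi).2.2 (S.block_subset_groupsUpTo (hmono.id_le k) t h))
    rw [Set.iUnion_singleton_eq_range] at this
    have := add_two_le_width k
    omega

/-- Pigeonhole on the vector of colours of `f p` in the groups before `k`. In a block, points of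
equal colour coincide. -/
theorem exists_rainbow_subset (k : ℕ) (f : X → X) (A : Finset X) :
    ∃ A' ⊆ A, A.card ≤ width k * A'.card ∧
      ∀ j < k, ∀ t, S.count j t (f '' A') ≤ 1 := by
  classical
  let c : X → ((j : Fin k) → Fin (blockSize j)) := fun p j => ⟨S.color j (f p), S.color_lt j _⟩
  obtain ⟨y, -, hy⟩ : ∃ y ∈ (Finset.univ : Finset ((j : Fin k) → Fin (blockSize j))),
      A.card ≤ width k * (A.filter (fun p => c p = y)).card := by
    by_contra! hcon
    have h1 := Finset.card_eq_sum_card_fiberwise (f := c) (s := A) (t := Finset.univ)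
      (fun _ _ => by simp)
    have hne : (Finset.univ : Finset ((j : Fin k) → Fin (blockSize j))).Nonempty :=
      ⟨fun j => ⟨0, blockSize_pos j⟩, Finset.mem_univ _⟩
    have h2 := Finset.sum_lt_sum_of_nonempty hne hcon
    rw [← Finset.mul_sum, ← h1, Finset.sum_const, Finset.card_univ, Fintype.card_pi] at h2
    simp only [Fintype.card_fin, smul_eq_mul] at h2
    exact absurd h2 (not_lt.2 (Nat.mul_le_mul_right _ (prod_blockSize_le_width k)))
  refine ⟨A.filter (fun p => c p = y), Finset.filter_subset _ _, hy, fun j hj t => ?_⟩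
  refine Finset.card_le_one.2 ?_
  intro p hp q hq
  simp only [Finset.mem_filter, Set.mem_image, Finset.coe_filter, Set.mem_ofPred_eq] at hp hq
  obtain ⟨hp, p', ⟨-, hp'⟩, rfl⟩ := hp
  obtain ⟨hq, q', ⟨-, hq'⟩, rfl⟩ := hq
  refine S.color_injOn j t hp hq ?_
  have := congrFun (hp'.trans hq'.symm) ⟨j, hj⟩
  simpa [c] using this

/-- Groups up to `K` have bounded block sizes, and a larger exponent absorbs any constant. -/
theorem exists_large_block {x : X} {P : Set X} (hP : ¬ S.Small x P) (r K : ℕ) :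
    ∃ k > K, S.owner k x ∧ ∃ t, width k ^ r < S.count k t P := by
  by_contra! hcon
  refine hP ⟨max r (width (K + 1)), fun k hk t => ?_⟩
  by_cases h : k ≤ K
  · calc S.count k t P ≤ blockSize k := S.count_le_blockSize k t P
      _ ≤ width (K + 1) := blockSize_le_width (by omega)
      _ ≤ max r (width (K + 1)) := le_max_right _ _
      _ ≤ _ := le_width_pow k _
  · exact (hcon k (by omega) hk t).trans (Nat.pow_le_pow_right (one_le_width k) (le_max_left _ _))

/-- A set that is not small at `x`, and on which the fibers of `f` are small at `x`, has a subset
that is not small at `x` whose image meets the blocks not owned by `x` in few points. -/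
theorem exists_subset_image_thin {x : X} {P : Set X} (hP : ¬ S.Small x P) (f : X → X)
    (hf : ∀ q ∈ f '' P, S.Small x (P ∩ f ⁻¹' {q})) :
    ∃ Q ⊆ P, ¬ S.Small x Q ∧ ∀ k, ¬ S.owner k x → ∀ t, S.count k t (f '' Q) ≤ width k ^ 2 := by
  classical
  have key : ∀ r K, ∃ k > K, S.owner k x ∧ ∃ t, ∃ A ⊆ S.block k t, (A : Set X) ⊆ P ∧
      (∀ p ∈ A, f p ∉ S.groupsUpTo K) ∧ width k ^ r < A.card ∧
      ∀ j < k, ∀ t, S.count j t (f '' A) ≤ 1 := by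
    intro r K
    have h1 : S.Small x (P ∩ f ⁻¹' S.groupsUpTo K) := by
      refine (Small.biUnion (I := S.groupsUpTo K ∩ f '' P)
        (E := fun q => P ∩ f ⁻¹' {q}) ((S.finite_groupsUpTo K).inter_of_left _)
        (fun q hq => hf q hq.2)).mono ?_
      rintro p ⟨hp, hpK⟩
      exact Set.mem_biUnion (x := f p) ⟨hpK, Set.mem_image_of_mem f hp⟩ ⟨hp, rfl⟩
    have h2 : ¬ S.Small x (P \ f ⁻¹' S.groupsUpTo K) := fun h => hP <| by
      simpa [Set.inter_union_sdiff] using h1.union h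
    -- The exponent `r + 1` pays for the factor `width k` lost in the pigeonhole.
    obtain ⟨k, hkK, hk, t, ht⟩ := S.exists_large_block h2 (r + 1) K
    obtain ⟨A, hA, hcard, hA1⟩ := S.exists_rainbow_subset k f
      ((S.block k t).filter (· ∈ P \ f ⁻¹' S.groupsUpTo K))
    refine ⟨k, hkK, hk, t, A, hA.trans (Finset.filter_subset _ _), fun p hp => ?_, fun p hp => ?_,
      ?_, hA1⟩
    · exact (Finset.mem_filter.1 (hA hp)).2.1
    · exact (Finset.mem_filter.1 (hA hp)).2.2
    · have : width k * width k ^ r < width k * A.card := by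
        rw [← pow_succ']; refine ht.trans_le (le_trans (le_of_eq ?_) hcard)
        unfold count; congr
      exact lt_of_mul_lt_mul_left this (Nat.zero_le _)
  choose nk hnk hown nt A hAb hAP hAK hAcard hA1 using key
  let K : ℕ → ℕ := fun n => Nat.rec 0 (fun r K => nk r K) n
  have hKs : ∀ n, K (n + 1) = nk n (K n) := fun _ => rfl
  have hK : StrictMono K := strictMono_nat_of_lt_succ fun n => by rw [hKs]; exact hnk n (K n)
  refine ⟨⋃ n, (A n (K n) : Set X), Set.iUnion_subset fun n => hAP n _, ?_, ?_⟩
  · rintro ⟨r, hr⟩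
    have h1 := hr _ (hown r (K r)) (nt r (K r))
    refine absurd (hAcard r (K r)) (not_lt.2 (le_trans (Finset.card_le_card ?_) h1))
    intro p hp
    simp only [Finset.mem_filter]
    exact ⟨hAb _ _ hp, Set.mem_iUnion.2 ⟨r, hp⟩⟩
  · intro k hk t
    rw [Set.image_iUnion]
    -- A piece from an earlier group has at most `width k` points, a piece from a later group has at
    -- most one image in the block, and pieces with `n ≥ k` miss it. Group `k` itself supplies no
    -- piece, since it is not owned by `x`.
    refine (S.count_iUnion_le k t k _ (width k) (fun n _ => ?_) (fun n hn => ?_)).trans ?_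
    · have hne : K (n + 1) ≠ k := fun h => hk (h ▸ hown n (K n))
      rcases lt_or_gt_of_ne hne with h | h
      · refine (S.count_le_ncard k t (Set.toFinite _)).trans ?_
        refine (Set.ncard_image_le (Finset.finite_toSet _)).trans ?_
        rw [Set.ncard_coe_finset]
        exact (Finset.card_le_card (hAb _ _)).trans
          ((S.card_block_le _ _).trans (blockSize_le_width h))
      · exact (hA1 n (K n) k h t).trans (one_le_width k)
    · rw [Set.disjoint_left]
      rintro _ ⟨p, hp, rfl⟩ hpB
      exact hAK n (K n) p hp (S.block_subset_groupsUpTo (hn.trans (hK.id_le n)) t hpB)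
    · rw [sq]
      exact Nat.mul_le_mul_right _ (by have := add_two_le_width k; omega)

end BlockSystem

theorem BlockSystem.small_inter_iff {X : Type*} {S : BlockSystem X} {x : X} {E F : Set X}
    (h : ∀ k, S.owner k x → ∀ t, (S.block k t : Set X) ⊆ F) :
    S.Small x (E ∩ F) ↔ S.Small x E := by
  refine ⟨fun ⟨r, hr⟩ => ⟨r, fun k hk t => le_trans ?_ (hr k hk t)⟩, fun H => H.mono inter_subset_left⟩
  classical
  refine Finset.card_le_card fun p hp => ?_
  simp only [Finset.mem_filter] at hp ⊢
  exact ⟨hp.1, hp.2, h k hk t hp.1⟩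

/-- A full block of group `k ≥ r` has `width k ^ (k + 2)` points, more than `width k ^ r`. -/
theorem BlockSystem.not_small_of_blocks {X : Type*} {S : BlockSystem X} {x : X} {E : Set X}
    (h : ∀ m, ∃ k ≥ m, S.owner k x ∧ ∃ t, (S.block k t).card = blockSize k ∧
      (S.block k t : Set X) ⊆ E) : ¬ S.Small x E := by
  rintro ⟨r, hr⟩
  obtain ⟨k, hk, ho, t, hc, hE⟩ := h r
  have h1 := hr k ho t
  have h2 : S.count k t E = blockSize k := by
    classical
    rw [← hc]
    unfold BlockSystem.count
    rw [Finset.filter_true_of_mem fun p hp => hE hp]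
  have := width_pow_lt_blockSize (k := k) (r := r) (by omega)
  omega

/-! ### The tree of grids and its topology -/

/-- The vertices of the infinitely branching tree. -/
abbrev Node : Type := List (ℕ × ℕ × ℕ)

/-- A pair of distinct vertices. -/
abbrev NodePair : Type := {z : Node × Node // z.1 ≠ z.2}

/-- The points of the example: the vertices of a tree, a point for each pair of distinct
vertices, and the limit point of a sequence of vertices. -/
inductive RigidSpace : Type
  | node (l : Node)
  | link (z : NodePair)
  | hub

namespace RigidSpace

instance : Countable RigidSpace := by
  let f : RigidSpace → Option (Node ⊕ NodePair) := fun x => match x with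
    | node l => some (Sum.inl l)
    | link z => some (Sum.inr z)
    | hub => none
  refine Function.Injective.countable (f := f) ?_
  rintro (a | z | _) (b | w | _) h <;> simp_all [f]

/-- The number of the `n`-th grid of children of `a`. -/
def gridCode (a : Node) (n : ℕ) : ℕ := Encodable.encode (a, n)

theorem le_gridCode (a : Node) (n : ℕ) : n ≤ gridCode a n := Nat.right_le_pair _ _

theorem gridCode_inj {a b : Node} {m n : ℕ} : gridCode a m = gridCode b n ↔ a = b ∧ m = n := by
  simp [gridCode]

/-- The entry in row `j` and column `i` of a grid. -/
def cell (g i j : ℕ) : RigidSpace :=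
  node (((Denumerable.ofNat (Node × ℕ) g).2, i, j) :: (Denumerable.ofNat (Node × ℕ) g).1)

@[simp] theorem cell_gridCode (a : Node) (n i j : ℕ) :
    cell (gridCode a n) i j = node ((n, i, j) :: a) := by
  simp [cell, gridCode]

theorem exists_gridCode (g : ℕ) : ∃ a n, gridCode a n = g :=
  ⟨_, _, Denumerable.encode_ofNat (α := Node × ℕ) g⟩

theorem cell_injective {g i j g' i' j' : ℕ} :
    cell g i j = cell g' i' j' ↔ g = g' ∧ i = i' ∧ j = j' := by
  obtain ⟨a, n, rfl⟩ := exists_gridCode g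
  obtain ⟨b, m, rfl⟩ := exists_gridCode g'
  simp only [cell_gridCode, gridCode_inj, node.injEq, List.cons.injEq, Prod.mk.injEq]
  tauto

open scoped Classical in
/-- Odd groups consist of the columns, even groups of the rows of a grid. -/
noncomputable def gridBlock (k t : ℕ) : Finset RigidSpace :=
  if k % 2 = 1 then
    if t < blockSize (k - 1) then (Finset.range (blockSize k)).image fun j => cell (k / 2) t j else ∅
  else
    if t < blockSize (k + 1) then (Finset.range (blockSize k)).image fun i => cell (k / 2) i t else ∅

theorem mem_gridBlock_column {g i : ℕ} {p : RigidSpace} : p ∈ gridBlock (2 * g + 1) i ↔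
    i < blockSize (2 * g) ∧ ∃ j < blockSize (2 * g + 1), cell g i j = p := by
  have h1 : (2 * g + 1) % 2 = 1 := by omega
  have h2 : (2 * g + 1) / 2 = g := by omega
  by_cases h : i < blockSize (2 * g) <;> simp [gridBlock, h1, h2, h]

theorem mem_gridBlock_row {g j : ℕ} {p : RigidSpace} : p ∈ gridBlock (2 * g) j ↔
    j < blockSize (2 * g + 1) ∧ ∃ i < blockSize (2 * g), cell g i j = p := by
  by_cases h : j < blockSize (2 * g + 1) <;> simp [gridBlock, h]

open scoped Classical in
theorem card_column {g i : ℕ} (h : i < blockSize (2 * g)) :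
    (gridBlock (2 * g + 1) i).card = blockSize (2 * g + 1) := by
  have h1 : (2 * g + 1) % 2 = 1 := by omega
  simp only [gridBlock, h1, if_true, Nat.add_sub_cancel, h]
  rw [Finset.card_image_of_injective _ fun _ _ h => (cell_injective.1 h).2.2, Finset.card_range]

open scoped Classical in
theorem card_row {g j : ℕ} (h : j < blockSize (2 * g + 1)) :
    (gridBlock (2 * g) j).card = blockSize (2 * g) := by
  simp only [gridBlock, Nat.mul_mod_right, zero_ne_one, if_false, h, if_true]
  rw [Finset.card_image_of_injective _ fun _ _ h => (cell_injective.1 h).2.1, Finset.card_range]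

/-- A vertex owns the columns of its grids. The point of a pair of vertices owns the rows of the
grids of these vertices that are reserved for the pair. -/
def Owns (k : ℕ) : RigidSpace → Prop
  | node a => ∃ n, k = 2 * gridCode a n + 1
  | link z => ∃ a n, (a = z.1.1 ∨ a = z.1.2) ∧
      k = 2 * gridCode a (Nat.pair (Encodable.encode z) n)
  | hub => False

/-- The second coordinate of a vertex in its grid. -/
def gridColor (k : ℕ) : RigidSpace → ℕ
  | node ((_, i, j) :: _) => if k % 2 = 1 then j else i
  | _ => 0

/-- The rows and columns of the grids. -/
noncomputable def grids : BlockSystem RigidSpace where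
  block := gridBlock
  owner := Owns
  color k p := if gridColor k p < blockSize k then gridColor k p else 0
  owner_unique := by
    rintro k (a | z | _) (b | w | _) h h' <;> simp only [Owns] at h h'
    · obtain ⟨n, rfl⟩ := h
      obtain ⟨m, hm⟩ := h'
      have : gridCode a n = gridCode b m := by omega
      rw [(gridCode_inj.1 this).1]
    · obtain ⟨n, rfl⟩ := h
      obtain ⟨_, m, _, hm⟩ := h'
      omega
    · obtain ⟨m, rfl⟩ := h'
      obtain ⟨_, n, _, hn⟩ := h
      omega
    · obtain ⟨_, n, -, rfl⟩ := h
      obtain ⟨_, m, -, hm⟩ := h'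
      have := (gridCode_inj.1 (Nat.eq_of_mul_eq_mul_left two_pos hm)).2
      rw [Nat.pair_eq_pair] at this
      rw [Encodable.encode_injective this.1]
  color_lt k p := by
    split_ifs with h
    · exact h
    · exact blockSize_pos k
  color_injOn k t := by
    intro p hp q hq hpq
    obtain ⟨g, rfl | rfl⟩ : ∃ g, k = 2 * g + 1 ∨ k = 2 * g := ⟨k / 2, by omega⟩
    · obtain ⟨-, j, hj, rfl⟩ := mem_gridBlock_column.1 hp
      obtain ⟨-, j', hj', rfl⟩ := mem_gridBlock_column.1 hq
      have h1 : (2 * g + 1) % 2 = 1 := by omega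
      simp_all [gridColor, cell]
    · obtain ⟨-, j, hj, rfl⟩ := mem_gridBlock_row.1 hp
      obtain ⟨-, j', hj', rfl⟩ := mem_gridBlock_row.1 hq
      simp_all [gridColor, cell]
  finite_group k := by
    have hfin (a b : ℕ) : ((fun q : ℕ × ℕ => cell (k / 2) q.1 q.2) ''
        (Set.Iio a ×ˢ Set.Iio b)).Finite :=
      ((Set.finite_Iio a).prod (Set.finite_Iio b)).image _
    obtain ⟨g, hg⟩ : ∃ g, k = 2 * g + 1 ∨ k = 2 * g := ⟨k / 2, by omega⟩
    refine (hfin (blockSize (2 * g)) (blockSize (2 * g + 1))).subset (Set.iUnion_subset ?_)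
    rintro t p hp
    have hkg : k / 2 = g := by omega
    rw [hkg]
    rcases hg with rfl | rfl
    · obtain ⟨h, j, hj, rfl⟩ := mem_gridBlock_column.1 hp
      exact ⟨(t, j), ⟨h, hj⟩, rfl⟩
    · obtain ⟨h, i, hi, rfl⟩ := mem_gridBlock_row.1 hp
      exact ⟨(i, t), ⟨hi, h⟩, rfl⟩

/-- The sequence of vertices that converges to the hub. -/
def hubSeq : Set RigidSpace := {p | ∃ n j, p = node [(n, 0, j)]}

/-- The sets whose complement is a neighborhood of `x` up to `x` itself: a set is open if its
complement is negligible at each of its points. -/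
def Negligible (x : RigidSpace) (E : Set RigidSpace) : Prop :=
  grids.Small x E ∧ (x = hub → (hubSeq ∩ E).Finite)

theorem Negligible.mono {x : RigidSpace} {E F : Set RigidSpace} (h : Negligible x F) (hEF : E ⊆ F) :
    Negligible x E :=
  ⟨h.1.mono hEF, fun hx => (h.2 hx).subset (inter_subset_inter_right _ hEF)⟩

theorem Negligible.union {x : RigidSpace} {E F : Set RigidSpace} (hE : Negligible x E)
    (hF : Negligible x F) : Negligible x (E ∪ F) :=
  ⟨hE.1.union hF.1, fun hx => by rw [inter_union_distrib_left]; exact (hE.2 hx).union (hF.2 hx)⟩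

theorem negligible_of_finite {x : RigidSpace} {E : Set RigidSpace} (hE : E.Finite) :
    Negligible x E :=
  ⟨BlockSystem.small_of_finite hE, fun _ => hE.inter_of_right _⟩

instance : TopologicalSpace RigidSpace where
  IsOpen U := ∀ x ∈ U, Negligible x Uᶜ
  isOpen_univ := fun x _ => by rw [compl_univ]; exact negligible_of_finite finite_empty
  isOpen_inter := fun U V hU hV x hx => by
    rw [compl_inter]; exact (hU x hx.1).union (hV x hx.2)
  isOpen_sUnion := fun 𝒰 h x ⟨U, hU, hx⟩ =>
    (h U hU x hx).mono (compl_subset_compl.2 (subset_sUnion_of_mem hU))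

theorem isOpen_def {U : Set RigidSpace} : IsOpen U ↔ ∀ x ∈ U, Negligible x Uᶜ := Iff.rfl

instance : T1Space RigidSpace where
  t1 x := ⟨fun y _ => by rw [compl_compl]; exact negligible_of_finite (finite_singleton x)⟩

theorem not_owns_hub (k : ℕ) : ¬ grids.owner k hub := fun h => h

theorem owner_node (a : Node) (n : ℕ) : grids.owner (2 * gridCode a n + 1) (node a) := ⟨n, rfl⟩

theorem owner_link {z : NodePair} {a : Node} (ha : a = z.1.1 ∨ a = z.1.2) (n : ℕ) :
    grids.owner (2 * gridCode a (Nat.pair (Encodable.encode z) n)) (link z) := ⟨a, n, ha, rfl⟩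

theorem negligible_hub {E : Set RigidSpace} : Negligible hub E ↔ (hubSeq ∩ E).Finite :=
  ⟨fun h => h.2 rfl, fun h => ⟨⟨0, fun k hk => absurd hk (not_owns_hub k)⟩, fun _ => h⟩⟩

theorem negligible_of_ne_hub {x : RigidSpace} (hx : x ≠ hub) {E : Set RigidSpace} :
    Negligible x E ↔ grids.Small x E :=
  ⟨fun h => h.1, fun h => ⟨h, fun h' => absurd h' hx⟩⟩

/-- The set of points near `x` on which its neighborhoods depend. -/
def nearby : RigidSpace → Set RigidSpace
  | node a => {p | ∃ n i j, i < blockSize (2 * gridCode a n) ∧ j < blockSize (2 * gridCode a n + 1) ∧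
      p = node ((n, i, j) :: a)}
  | link z => {p | ∃ a n i j, (a = z.1.1 ∨ a = z.1.2) ∧
      j < blockSize (2 * gridCode a (Nat.pair (Encodable.encode z) n) + 1) ∧
      p = node ((Nat.pair (Encodable.encode z) n, i, j) :: a)}
  | hub => hubSeq

/-- The vertices whose children are nearby. -/
def roots : RigidSpace → Set Node
  | node a => {a}
  | link z => {z.1.1, z.1.2}
  | hub => {[]}

theorem finite_roots (x : RigidSpace) : (roots x).Finite := by
  rcases x with a | z | _ <;> simp [roots]

theorem exists_root {x p : RigidSpace} (hp : p ∈ nearby x) :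
    ∃ a ∈ roots x, ∃ m, p = node (m :: a) := by
  rcases x with a | z | _
  · obtain ⟨n, i, j, -, -, rfl⟩ := hp; exact ⟨a, rfl, _, rfl⟩
  · obtain ⟨a, n, i, j, h, -, rfl⟩ := hp; exact ⟨a, h, _, rfl⟩
  · obtain ⟨n, j, rfl⟩ := hp; exact ⟨[], rfl, _, rfl⟩

theorem block_subset_nearby {x : RigidSpace} {k : ℕ} (hk : grids.owner k x) (t : ℕ) :
    (grids.block k t : Set RigidSpace) ⊆ nearby x := by
  rcases x with a | z | _
  · obtain ⟨n, rfl⟩ := hk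
    intro p hp
    obtain ⟨h, j, hj, rfl⟩ := mem_gridBlock_column.1 hp
    exact ⟨n, t, j, h, hj, by simp⟩
  · obtain ⟨a, n, ha, rfl⟩ := hk
    intro p hp
    obtain ⟨h, i, hi, rfl⟩ := mem_gridBlock_row.1 hp
    exact ⟨a, n, i, t, ha, h, by simp⟩
  · exact absurd hk (not_owns_hub k)

theorem negligible_inter_nearby {x : RigidSpace} {E : Set RigidSpace} :
    Negligible x (E ∩ nearby x) ↔ Negligible x E := by
  refine ⟨fun h => ⟨(BlockSystem.small_inter_iff fun k hk t => block_subset_nearby hk t).1 h.1,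
    fun hx => ?_⟩, fun h => h.mono inter_subset_left⟩
  have := h.2 hx
  subst hx
  exact this.subset fun p hp => ⟨hp.1, hp.2, hp.1⟩

theorem not_negligible_nearby_diff {x y : RigidSpace} (hxy : x ≠ y) :
    ¬ Negligible y (nearby y \ nearby x) := by
  rcases y with a | z | _
  · rw [negligible_of_ne_hub (by simp)]
    -- If `x` is a link, grids with label `e` are not reserved for it. Column 1 is used below
    -- because `hubSeq` lies in column 0.
    obtain ⟨e, he⟩ : ∃ e, ∀ z, x = link z → Encodable.encode z ≠ e := by
      rcases x with b | w | _
      · exact ⟨0, by simp⟩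
      · exact ⟨Encodable.encode w + 1, by rintro _ h; cases h; omega⟩
      · exact ⟨0, by simp⟩
    refine BlockSystem.not_small_of_blocks fun m => ⟨2 * gridCode a (Nat.pair e m) + 1, ?_,
      owner_node _ _, 1, card_column ?_, fun p hp => ⟨block_subset_nearby (owner_node _ _) 1 hp, ?_⟩⟩
    · have := le_gridCode a (Nat.pair e m)
      have := Nat.right_le_pair e m
      omega
    · simpa using width_pow_lt_blockSize (k := 2 * gridCode a (Nat.pair e m)) (r := 0) (by omega)
    · obtain ⟨h, j, hj, rfl⟩ := mem_gridBlock_column.1 hp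
      rw [cell_gridCode]
      intro hx
      rcases x with b | w | _
      · obtain ⟨_, _, _, -, -, h⟩ := hx
        simp at h
        simp [h.2] at hxy
      · obtain ⟨_, _, _, _, -, -, h⟩ := hx
        simp [Nat.pair_eq_pair] at h
        exact he w rfl h.1.1.1.symm
      · obtain ⟨_, _, h⟩ := hx
        simp at h
  · rw [negligible_of_ne_hub (by simp)]
    -- Of the two ends of the link, at least one has children that are not nearby a given vertex or
    -- the hub.
    obtain ⟨b, hb, hbx⟩ : ∃ b, (b = z.1.1 ∨ b = z.1.2) ∧ ∀ a, (x = node a ∨ x = hub ∧ a = []) →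
        b ≠ a := by
      have hz := z.2
      rcases x with a | w | _
      · by_cases h : z.1.1 = a
        · exact ⟨_, Or.inr rfl, by rintro _ (h' | h') <;> simp_all [eq_comm]⟩
        · exact ⟨_, Or.inl rfl, by rintro _ (h' | h') <;> simp_all⟩
      · exact ⟨_, Or.inl rfl, by simp⟩
      · by_cases h : z.1.1 = []
        · exact ⟨_, Or.inr rfl, by simp_all [eq_comm]⟩
        · exact ⟨_, Or.inl rfl, by simp_all⟩
    refine BlockSystem.not_small_of_blocks fun m =>
      ⟨2 * gridCode b (Nat.pair (Encodable.encode z) m), ?_,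
      owner_link hb m, 0, card_row (blockSize_pos _),
      fun p hp => ⟨block_subset_nearby (owner_link hb m) 0 hp, ?_⟩⟩
    · have := le_gridCode b (Nat.pair (Encodable.encode z) m)
      have := Nat.right_le_pair (Encodable.encode z) m
      omega
    · obtain ⟨h, i, hi, rfl⟩ := mem_gridBlock_row.1 hp
      rw [cell_gridCode]
      intro hx
      rcases x with a | w | _
      · obtain ⟨_, _, _, -, -, h⟩ := hx
        simp at h
        exact hbx a (Or.inl rfl) h.2
      · obtain ⟨_, _, _, _, -, -, h⟩ := hx
        simp [Nat.pair_eq_pair] at h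
        exact hxy (by rw [h.1.1.1])
      · obtain ⟨_, _, h⟩ := hx
        simp at h
        exact hbx [] (Or.inr ⟨rfl, rfl⟩) h.2
  · rw [negligible_hub]
    -- Entries beyond the last row of the grid lie in no block, so they are nearby the hub only.
    have hinj : Function.Injective fun j =>
        node [(0, 0, j + blockSize (2 * gridCode [] 0 + 1))] := fun i j h => by simpa using h
    refine fun h => Set.infinite_range_of_injective hinj (h.subset ?_)
    rintro _ ⟨j, rfl⟩
    refine ⟨⟨_, _, rfl⟩, ⟨_, _, rfl⟩, fun hx => ?_⟩
    rcases x with b | w | _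
    · obtain ⟨_, _, _, -, h, h'⟩ := hx
      simp at h'
      obtain ⟨⟨rfl, rfl, rfl⟩, rfl⟩ := h'
      omega
    · obtain ⟨_, _, _, _, -, h, h'⟩ := hx
      simp at h'
      obtain ⟨⟨h0, rfl, rfl⟩, rfl⟩ := h'
      rw [← h0] at h
      omega
    · exact hxy rfl

end RigidSpace

/-! ### Semi-Hausdorff and Brown properties -/

namespace RigidSpace

/-- The descendants of a vertex. -/
def cone (a : Node) : Set RigidSpace := {p | ∃ l, a <:+ l ∧ p = node l}

theorem node_mem_cone {a l : Node} : node l ∈ cone a ↔ a <:+ l := by simp [cone]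

theorem isOpen_cone (a : Node) : IsOpen (cone a) := by
  rintro _ ⟨l, hl, rfl⟩
  rw [← negligible_inter_nearby]
  refine negligible_of_finite (Set.finite_empty.subset ?_)
  rintro _ ⟨hp, n, i, j, -, -, rfl⟩
  exact hp (node_mem_cone.2 (hl.trans (List.suffix_cons _ _)))

theorem finite_setOf_suffix (l : Node) : {a : Node | a <:+ l}.Finite :=
  l.tails.finite_toSet.subset fun a ha => by simpa using ha

/-- The vertices with a descendant among the roots of `y`. -/
def aboveRoots (y : RigidSpace) : Set Node := {a | ∃ b ∈ roots y, a <:+ b}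

theorem finite_aboveRoots (y : RigidSpace) : (aboveRoots y).Finite := by
  have : aboveRoots y = ⋃ b ∈ roots y, {a | a <:+ b} := by ext; simp [aboveRoots]
  rw [this]
  exact (finite_roots y).biUnion fun b _ => finite_setOf_suffix b

/-- A neighborhood of `x` contained in the cones over nearby vertices. -/
def basicNhd (x y : RigidSpace) : Set RigidSpace :=
  {x} ∪ ⋃ p ∈ {p : Node | node p ∈ nearby x ∧ p ∉ aboveRoots y}, cone p

theorem isOpen_basicNhd (x y : RigidSpace) : IsOpen (basicNhd x y) := by
  rw [isOpen_def]
  rintro w (rfl | hw)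
  · rw [← negligible_inter_nearby]
    refine negligible_of_finite (((finite_aboveRoots y).image node).subset ?_)
    rintro q ⟨hq, hqw⟩
    obtain ⟨a, -, m, rfl⟩ := exists_root hqw
    by_contra h
    refine hq (Or.inr (mem_biUnion (x := m :: a) ⟨hqw, fun h' => h ⟨_, h', rfl⟩⟩ ?_))
    exact node_mem_cone.2 List.suffix_rfl
  · have ho : IsOpen (⋃ p ∈ {p : Node | node p ∈ nearby x ∧ p ∉ aboveRoots y}, cone p) :=
      isOpen_biUnion fun p _ => isOpen_cone p
    exact (ho w hw).mono (compl_subset_compl.2 subset_union_right)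

/-- Intersecting cones are nested. Since their apexes are children of roots, a proper nesting would
put one apex above a root of the other point, which is excluded. -/
theorem disjoint_cone_basicNhd {x y : RigidSpace} {p : Node} (hp : node p ∈ nearby y \ nearby x)
    (hpx : p ∉ aboveRoots x) : Disjoint (cone p) (basicNhd x y) := by
  rw [Set.disjoint_left]
  rintro _ ⟨l, hl, rfl⟩ (rfl | hw)
  · exact hpx ⟨l, rfl, hl⟩
  · simp only [mem_iUnion] at hw
    obtain ⟨p', ⟨hp'x, hp'y⟩, hl'⟩ := hw
    obtain ⟨b, hb, m, hm⟩ := exists_root hp.1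
    obtain ⟨c, hc, m', hm'⟩ := exists_root hp'x
    rw [node.injEq] at hm hm'
    rcases List.suffix_or_suffix_of_suffix hl (node_mem_cone.1 hl') with h | h
    · rw [hm', List.suffix_cons_iff] at h
      rcases h with rfl | h
      · exact hp.2 (hm' ▸ hp'x)
      · exact hpx ⟨c, hc, h⟩
    · rw [hm, List.suffix_cons_iff] at h
      rcases h with rfl | h
      · exact hp.2 (hm ▸ hp'x)
      · exact hp'y ⟨b, hb, h⟩

theorem semiHausdorff : SemiHausdorff RigidSpace := by
  intro x y hxy
  refine ⟨interior (closure (basicNhd x y)), ?_, ?_, fun hy => ?_⟩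
  · refine subset_antisymm ?_ ?_
    · exact interior_mono (closure_minimal interior_subset isClosed_closure)
    · exact interior_maximal subset_closure isOpen_interior
  · exact interior_maximal subset_closure (isOpen_basicNhd x y) (Or.inl rfl)
  · refine not_negligible_nearby_diff hxy (((isOpen_def.1 isOpen_interior y hy).union
      (negligible_of_finite ((finite_aboveRoots x).image node))).mono fun q hq => ?_)
    obtain ⟨a, -, m, rfl⟩ := exists_root hq.1
    by_contra h
    simp only [mem_union, not_or, mem_compl_iff, not_not] at h
    have hx : m :: a ∉ aboveRoots x := fun h' => h.2 ⟨_, h', rfl⟩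
    have := mem_closure_iff.1 (interior_subset h.1) _ (isOpen_cone _)
      (node_mem_cone.2 List.suffix_rfl)
    exact not_disjoint_iff_nonempty_inter.2 this (disjoint_cone_basicNhd hq hx)

open scoped Classical in
theorem count_column {g i : ℕ} (h : i < blockSize (2 * g)) (E : Set RigidSpace) :
    grids.count (2 * g + 1) i E =
      ∑ j ∈ Finset.range (blockSize (2 * g + 1)), if cell g i j ∈ E then 1 else 0 := by
  have h1 : (2 * g + 1) % 2 = 1 := by omega
  have h2 : (2 * g + 1) / 2 = g := by omega
  rw [← Finset.card_filter]
  unfold BlockSystem.count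
  have hb : grids.block (2 * g + 1) i =
      (Finset.range (blockSize (2 * g + 1))).image fun j => cell g i j := by
    simp only [grids, gridBlock, h1, if_true, Nat.add_sub_cancel, h, h2]
  rw [hb, Finset.filter_image,
    Finset.card_image_of_injective _ fun _ _ h => (cell_injective.1 h).2.2]

open scoped Classical in
theorem count_row {g j : ℕ} (h : j < blockSize (2 * g + 1)) (E : Set RigidSpace) :
    grids.count (2 * g) j E =
      ∑ i ∈ Finset.range (blockSize (2 * g)), if cell g i j ∈ E then 1 else 0 := by
  rw [← Finset.card_filter]
  unfold BlockSystem.count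
  have hb : grids.block (2 * g) j =
      (Finset.range (blockSize (2 * g))).image fun i => cell g i j := by
    simp [grids, gridBlock, h]
  rw [hb, Finset.filter_image,
    Finset.card_image_of_injective _ fun _ _ h => (cell_injective.1 h).2.1]

theorem two_mul_width_pow_lt {k r : ℕ} (h : r ≤ k) : 2 * width k ^ r < blockSize k :=
  lt_of_le_of_lt (Nat.mul_le_mul_right _ (two_le_width k))
    (by rw [← pow_succ']; exact width_pow_lt_blockSize (by omega))

/-- Double counting: in a late grid, the complement of `U` takes less than half of every column and
the complement of `V` less than half of every row, so they cannot cover the grid. -/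
theorem link_mem_closure {U : Set RigidSpace} (hU : IsOpen U) {a : Node} (haU : node a ∈ U)
    {z : NodePair} (ha : a = z.1.1 ∨ a = z.1.2) : link z ∈ closure U := by
  classical
  rw [mem_closure_iff]
  intro V hV hzV
  obtain ⟨r, hr⟩ := (hU _ haU).1
  obtain ⟨s, hs⟩ := (hV _ hzV).1
  -- The index `max r s` makes the group numbers `2 * g` and `2 * g + 1` at least as large as both
  -- exponents.
  set g := gridCode a (Nat.pair (Encodable.encode z) (max r s)) with hg
  have hgm : max r s ≤ g := (Nat.right_le_pair _ _).trans (le_gridCode _ _)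
  have hr' := hr (2 * g + 1) (owner_node a _)
  have hs' := hs (2 * g) (owner_link ha _)
  by_contra hne
  have hdis : ∀ i j, 1 ≤ (if cell g i j ∈ Uᶜ then 1 else 0) + if cell g i j ∈ Vᶜ then 1 else 0 := by
    intro i j
    by_cases h : cell g i j ∈ U
    · have : cell g i j ∉ V := fun h' => hne ⟨_, h', h⟩
      simp [h, this]
    · simp [h]
  have h1 : ∑ i ∈ Finset.range (blockSize (2 * g)), ∑ j ∈ Finset.range (blockSize (2 * g + 1)), 1 ≤
      ∑ i ∈ Finset.range (blockSize (2 * g)), ∑ j ∈ Finset.range (blockSize (2 * g + 1)),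
        ((if cell g i j ∈ Uᶜ then 1 else 0) + if cell g i j ∈ Vᶜ then 1 else 0) :=
    Finset.sum_le_sum fun i _ => Finset.sum_le_sum fun j _ => hdis i j
  simp only [Finset.sum_add_distrib] at h1
  have h2 : ∑ i ∈ Finset.range (blockSize (2 * g)), ∑ j ∈ Finset.range (blockSize (2 * g + 1)),
      (if cell g i j ∈ Uᶜ then 1 else 0) ≤ blockSize (2 * g) * width (2 * g + 1) ^ r := by
    refine (Finset.sum_le_card_nsmul _ _ (width (2 * g + 1) ^ r) fun i hi => ?_).trans (by simp)
    have := hr' i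
    rw [count_column (Finset.mem_range.1 hi)] at this
    exact le_trans (le_of_eq (Finset.sum_congr rfl fun _ _ => by congr)) this
  have h3 : ∑ i ∈ Finset.range (blockSize (2 * g)), ∑ j ∈ Finset.range (blockSize (2 * g + 1)),
      (if cell g i j ∈ Vᶜ then 1 else 0) ≤ blockSize (2 * g + 1) * width (2 * g) ^ s := by
    rw [Finset.sum_comm]
    refine (Finset.sum_le_card_nsmul _ _ (width (2 * g) ^ s) fun j hj => ?_).trans (by simp)
    have := hs' j
    rw [count_row (Finset.mem_range.1 hj)] at this
    exact le_trans (le_of_eq (Finset.sum_congr rfl fun _ _ => by congr)) this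
  simp only [Finset.sum_const, Finset.card_range, smul_eq_mul, mul_one] at h1
  have h4 := two_mul_width_pow_lt (k := 2 * g + 1) (r := r) (by omega)
  have h5 := two_mul_width_pow_lt (k := 2 * g) (r := s) (by omega)
  have := blockSize_pos (2 * g)
  have := blockSize_pos (2 * g + 1)
  nlinarith

theorem infinite_inter_nearby {U : Set RigidSpace} (hU : IsOpen U) {x : RigidSpace} (hx : x ∈ U) :
    (U ∩ nearby x).Infinite := by
  intro hfin
  obtain ⟨w, hw⟩ : ∃ w, w ≠ x := by
    rcases x with a | z | _
    exacts [⟨hub, by simp⟩, ⟨hub, by simp⟩, ⟨node [], by simp⟩]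
  refine not_negligible_nearby_diff hw (((hU x hx).union (negligible_of_finite hfin)).mono ?_)
  intro p hp
  by_cases h : p ∈ U
  · exact Or.inr ⟨h, hp.1⟩
  · exact Or.inl h

theorem infinite_nodes {U : Set RigidSpace} (hU : IsOpen U) (hne : U.Nonempty) :
    {a | node a ∈ U}.Infinite := by
  obtain ⟨x, hx⟩ := hne
  intro hfin
  refine infinite_inter_nearby hU hx ((hfin.image node).subset ?_)
  rintro p ⟨hpU, hp⟩
  obtain ⟨a, -, m, rfl⟩ := exists_root hp
  exact ⟨_, hpU, rfl⟩

/-- With a vertex `b` of `V` fixed, the links from the infinitely many other vertices of `U` to `b`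
lie in both closures. -/
theorem brown : Brown RigidSpace := by
  intro U V hU hV hUne hVne
  obtain ⟨b, hb⟩ := (infinite_nodes hV hVne).nonempty
  have hinf : ({a | node a ∈ U} \ {b}).Infinite :=
    (infinite_nodes hU hUne).sdiff (finite_singleton b)
  have := hinf.to_subtype
  have hinj : Function.Injective fun a : ↥({a | node a ∈ U} \ {b}) => link ⟨(a, b), a.2.2⟩ := by
    intro a a' h
    simpa [Subtype.ext_iff] using h
  refine (Set.infinite_range_of_injective hinj).mono ?_
  rintro _ ⟨a, rfl⟩
  exact ⟨link_mem_closure hU a.2.1 (Or.inl rfl), link_mem_closure hV hb (Or.inr rfl)⟩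

end RigidSpace

/-! ### Strong rigidity -/

namespace RigidSpace

variable {f : RigidSpace → RigidSpace} {x y : RigidSpace}

theorem negligible_preimage_compl (hf : Continuous f) {V : Set RigidSpace} (hV : IsOpen V)
    (hx : f x ∈ V) : Negligible x (f ⁻¹' V)ᶜ := hV.preimage hf x hx

theorem negligible_fiber (hf : Continuous f) (h : f x ≠ y) : Negligible x (f ⁻¹' {y}) := by
  simpa [preimage_compl] using
    negligible_preimage_compl hf (isOpen_compl_singleton (x := y)) (x := x) (by simpa using h)

theorem isClosed_of_thin {E : Set RigidSpace} (hE : ∀ w, w ∉ E → grids.Small w E)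
    (hhub : hub ∉ E → (hubSeq ∩ E).Finite) : IsClosed E := by
  rw [← isOpen_compl_iff, isOpen_def]
  intro w hw
  rw [compl_compl]
  exact ⟨hE w hw, fun h => hhub (h ▸ hw)⟩

/-- If `f` moves `x`, then `f` is almost everywhere equal to `f x` near `x`, except possibly
for values on the sequence converging to the hub. -/
theorem negligible_of_ne (hf : Continuous f) (hx : x ≠ hub) (hfx : f x ≠ x) {E : Set RigidSpace}
    (hE : f x ∉ f '' E) (hhub : f x = hub → Disjoint hubSeq (f '' E)) : Negligible x E := by
  by_contra hcon
  rw [negligible_of_ne_hub hx] at hcon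
  obtain ⟨Q, hQE, hQ, hthin⟩ := grids.exists_subset_image_thin hcon f fun q hq =>
    ((negligible_fiber hf (y := q) (x := x) fun h => hE (h ▸ hq)).mono inter_subset_right).1
  -- The image may fail to be negligible only at `x` and at the hub. Adding these points makes it
  -- closed; `x ≠ f x` may be added, and if `f x` is the hub, `hhub` replaces the second addition.
  have hclosed : IsClosed (f '' Q ∪ {x, hub} \ {f x}) := by
    refine isClosed_of_thin (fun w hw => ?_) fun hw => ?_
    · refine BlockSystem.Small.union ⟨2, fun k hk t => hthin k (fun h => hw (Or.inr ?_)) t⟩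
        (BlockSystem.small_of_finite ((Set.toFinite _).sdiff))
      rw [grids.owner_unique k w x hk h]
      exact ⟨Or.inl rfl, fun h => hfx h.symm⟩
    · have hfh : f x = hub := by
        by_contra h
        exact hw (Or.inr ⟨Or.inr rfl, fun h' => h h'.symm⟩)
      rw [inter_union_distrib_left, ((hhub hfh).mono_right (image_mono hQE)).inter_eq, empty_union]
      exact ((Set.toFinite _).sdiff).inter_of_right _
  refine hQ ((negligible_preimage_compl hf hclosed.isOpen_compl (x := x) ?_).mono ?_).1
  · rintro (h | h)
    · exact hE (image_mono hQE h)
    · exact h.2 rfl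
  · intro p hp hp'
    exact hp' (Or.inl (mem_image_of_mem f hp))

theorem negligible_fiber_compl (hf : Continuous f) (hfx : f x ≠ x) (hne : f x ≠ hub) :
    Negligible x (f ⁻¹' {f x})ᶜ := by
  -- At the hub, negligible means finite on `hubSeq`: fibers over other values are finite there, so
  -- an infinite exceptional set has an infinite image with an infinite thin subset, closed once the
  -- hub is added.
  by_cases hx : x = hub
  · subst hx
    rw [negligible_hub]
    by_contra hinf
    have himg : (f '' (hubSeq ∩ (f ⁻¹' {f hub})ᶜ)).Infinite := by
      intro hfin
      refine hinf (Set.Finite.of_finite_fibers f hfin fun q hq => ?_)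
      obtain ⟨p, hp, rfl⟩ := hq
      refine ((negligible_hub.1 (negligible_fiber hf (y := f p) fun h => hp.2 h.symm))).subset ?_
      rintro p' ⟨hp', h⟩
      exact ⟨hp'.1, h⟩
    obtain ⟨F, hF, hFinf, hthin⟩ := grids.exists_infinite_thin_subset himg
    have hclosed : IsClosed (F ∪ {hub}) :=
      isClosed_of_thin (fun w _ => BlockSystem.Small.union
        ⟨1, fun k _ t => by simpa using hthin k t⟩
        (BlockSystem.small_of_finite (finite_singleton _))) fun h => absurd (Or.inr rfl) h
    have := negligible_hub.1 (negligible_preimage_compl hf hclosed.isOpen_compl (x := hub) (by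
      rintro (h | h)
      · obtain ⟨p, hp, h⟩ := hF h
        exact hp.2 h
      · exact hne h))
    refine hFinf ((this.image f).subset fun q hq => ?_)
    obtain ⟨p, hp, rfl⟩ := hF hq
    exact ⟨p, ⟨hp.1, fun h => h (Or.inl hq)⟩, rfl⟩
  · refine negligible_of_ne hf hx hfx ?_ fun h => absurd h hne
    rintro ⟨p, hp, h⟩
    exact hp h

/-- `hubSeq` lies in column 0 of the grids of the root, so it meets each row at most once. At the
root it contains whole columns, hence the exception. -/
theorem negligible_hubSeq {x : RigidSpace} (h : x ≠ node []) (hx : x ≠ hub) :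
    Negligible x hubSeq := by
  rw [negligible_of_ne_hub hx]
  rcases x with a | z | _
  · refine ((negligible_inter_nearby (x := node a)).1
      (negligible_of_finite (finite_empty.subset ?_))).1
    rintro _ ⟨⟨n, j, rfl⟩, _, _, _, -, -, h'⟩
    simp at h'
    exact h (by rw [h'.2])
  · refine ⟨0, fun k hk t => ?_⟩
    obtain ⟨a, n, -, rfl⟩ := hk
    classical
    refine Finset.card_le_one.2 fun p hp q hq => ?_
    rw [Finset.mem_filter] at hp hq
    obtain ⟨-, i, -, rfl⟩ := mem_gridBlock_row.1 hp.1
    obtain ⟨-, i', -, rfl⟩ := mem_gridBlock_row.1 hq.1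
    obtain ⟨_, _, h1⟩ := hp.2
    obtain ⟨_, _, h2⟩ := hq.2
    simp at h1 h2
    rw [h1.1.2.1, h2.1.2.1]
  · exact absurd rfl hx

/-- The part of a fiber where `f` moves points, without the root in the fiber of the hub. -/
def movedFiber (f : RigidSpace → RigidSpace) (y : RigidSpace) : Set RigidSpace :=
  f ⁻¹' {y} \ ({y} ∪ {x | y = hub ∧ x = node []})

theorem finite_fiber_diff_movedFiber : (f ⁻¹' {y} \ movedFiber f y).Finite := by
  refine (Set.toFinite ({y, node []} : Set RigidSpace)).subset ?_
  rintro p ⟨hp, hp'⟩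
  by_contra h
  simp only [mem_insert_iff, mem_singleton_iff, not_or] at h
  exact hp' ⟨hp, by rintro (h' | h'); exacts [h.1 h', h.2 h'.2]⟩

/-- Distinct fibers are disjoint closed sets, so they cannot both contain nonempty open sets in a
Brown space. -/
theorem movedFiber_unique_of_isOpen (hf : Continuous f) {y y' : RigidSpace}
    (ho : IsOpen (movedFiber f y)) (ho' : IsOpen (movedFiber f y'))
    (hy : (movedFiber f y).Nonempty) (hy' : (movedFiber f y').Nonempty) : y = y' := by
  by_contra hne
  refine brown _ _ ho ho' hy hy' (finite_empty.subset ?_)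
  rintro p ⟨hp, hp'⟩
  have hc (y) : IsClosed (f ⁻¹' {y}) := isClosed_singleton.preimage hf
  have h1 : f p = y := closure_minimal (fun _ h => h.1) (hc y) hp
  have h2 : f p = y' := closure_minimal (fun _ h => h.1) (hc y') hp'
  exact hne (h1.symm.trans h2)

theorem isOpen_movedFiber_of_ne_hub (hf : Continuous f) (hy : y ≠ hub) :
    IsOpen (movedFiber f y) := by
  rw [isOpen_def]
  rintro x ⟨rfl, hx⟩
  have hfx : f x ≠ x := fun h => hx (Or.inl h.symm)
  refine ((negligible_fiber_compl hf hfx hy).union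
    (negligible_of_finite (finite_fiber_diff_movedFiber (f := f) (y := f x)))).mono fun p hp => ?_
  by_cases h : p ∈ f ⁻¹' {f x}
  · exact Or.inr ⟨h, hp⟩
  · exact Or.inl h

/-- If `f` maps `x` to the hub, then near `x` almost every point is mapped to the hub or
is a fixed point on the sequence converging to the hub. -/
theorem negligible_hub_fiber_compl (hf : Continuous f) (hx : x ≠ hub) (hfx : f x = hub) :
    Negligible x (f ⁻¹' {hub} ∪ hubSeq)ᶜ := by
  have h1 : Negligible x (f ⁻¹' (insert hub hubSeq))ᶜ := by
    refine negligible_of_ne hf hx (by rw [hfx]; exact hx.symm) ?_ fun _ => ?_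
    · rintro ⟨p, hp, h⟩
      exact hp (Or.inl (h.trans hfx))
    · rw [Set.disjoint_right]
      rintro _ ⟨p, hp, rfl⟩ h
      exact hp (Or.inr h)
  have hhub : ∀ q ∈ hubSeq, q ≠ hub := by rintro _ ⟨n, j, rfl⟩; simp
  -- At most one `q` in `hubSeq` has a nonempty moved fiber. Once its fiber is discarded, a point
  -- with value in `hubSeq` is fixed and thus lies in `hubSeq`.
  obtain ⟨y, hy, hyu⟩ : ∃ y, y ≠ hub ∧ ∀ q ∈ hubSeq, (movedFiber f q).Nonempty → q = y := by
    by_cases h : ∃ y ∈ hubSeq, (movedFiber f y).Nonempty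
    · obtain ⟨y, hy, hne⟩ := h
      exact ⟨y, hhub y hy, fun q hq hqn => movedFiber_unique_of_isOpen hf
        (isOpen_movedFiber_of_ne_hub hf (hhub q hq))
        (isOpen_movedFiber_of_ne_hub hf (hhub y hy)) hqn hne⟩
    · exact ⟨x, hx, fun q hq hqn => absurd ⟨q, hq, hqn⟩ h⟩
  refine (h1.union (negligible_fiber hf (y := y) (x := x) (by rw [hfx]; exact hy.symm))).mono ?_
  intro p hp
  by_contra hcon
  simp only [mem_union, mem_compl_iff, mem_preimage, mem_insert_iff, mem_singleton_iff, not_or]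
    at hcon hp
  have hq : f p ∈ hubSeq := by_contra fun h => hcon.1 ⟨hp.1, h⟩
  refine hcon.2 (hyu _ hq ⟨p, rfl, ?_⟩)
  rintro (h | h)
  · exact hp.2 (by rw [mem_singleton_iff.1 h]; exact hq)
  · exact hp.1 h.1

theorem isOpen_movedFiber (hf : Continuous f) (y : RigidSpace) : IsOpen (movedFiber f y) := by
  by_cases hy : y = hub
  · subst hy
    rw [isOpen_def]
    rintro x ⟨hfx, hx⟩
    have hxh : x ≠ hub := fun h => hx (Or.inl h)
    have hxn : x ≠ node [] := fun h => hx (Or.inr ⟨rfl, h⟩)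
    refine (((negligible_hub_fiber_compl hf hxh hfx).union (negligible_hubSeq hxn hxh)).union
      (negligible_of_finite (finite_fiber_diff_movedFiber (f := f) (y := hub)))).mono fun p hp => ?_
    by_cases h : p ∈ f ⁻¹' {hub}
    · exact Or.inr ⟨h, hp⟩
    · by_cases h' : p ∈ hubSeq
      · exact Or.inl (Or.inr h')
      · exact Or.inl (Or.inl fun h'' => h''.elim h h')
  · exact isOpen_movedFiber_of_ne_hub hf hy

theorem stronglyRigid : StronglyRigid RigidSpace := by
  intro f hf hid
  by_cases h : ∃ y, (movedFiber f y).Nonempty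
  · obtain ⟨y, hy⟩ := h
    refine ⟨y, ?_⟩
    by_contra! hne
    have hc : IsClosed (f ⁻¹' {y}) := isClosed_singleton.preimage hf
    -- The closures of the moved fiber and of the complement of the fiber meet only in the finitely
    -- many points removed from the fiber.
    refine brown _ _ (isOpen_movedFiber hf y) hc.isOpen_compl hy hne
      ((finite_fiber_diff_movedFiber (f := f) (y := y)).subset ?_)
    rintro p ⟨hp, hp'⟩
    refine ⟨closure_minimal (fun _ h => h.1) hc hp, ?_⟩
    exact closure_minimal (t := (movedFiber f y)ᶜ) (fun q (hq : q ∈ (f ⁻¹' {y})ᶜ) hq' => hq hq'.1)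
      (isOpen_movedFiber hf y).isClosed_compl hp'
  · exfalso
    have hfix : ∀ x, f x = x ∨ f x = hub ∧ x = node [] := by
      intro x
      by_contra! hx
      refine h ⟨f x, x, rfl, ?_⟩
      rintro (h' | h')
      · exact hx.1 (mem_singleton_iff.1 h').symm
      · exact hx.2 h'.1 h'.2
    have hroot : f (node []) = hub := by
      by_contra hr
      exact hid (funext fun x => (hfix x).resolve_right fun hx => hr (hx.2 ▸ hx.1))
    -- Only the root could be moved, to the hub. But then almost all its children outside `hubSeq`
    -- would go to the hub, although they are fixed.
    refine not_negligible_nearby_diff (x := hub) (y := node []) (by simp)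
      (((negligible_hub_fiber_compl hf (by simp) hroot).union
        (negligible_of_finite (Set.toFinite {hub, node []}))).mono ?_)
    rintro p ⟨-, hp⟩
    by_cases h' : f p = hub
    · rcases hfix p with h'' | h''
      · exact Or.inr (Or.inl (h''.symm.trans h'))
      · exact Or.inr (Or.inr h''.2)
    · exact Or.inl fun h'' => h''.elim h' hp

/-- A retraction followed by the inclusion is the identity or constant, so `A` is the whole space or
has at most one point. -/
theorem isClosed_of_isRetractOf {A : Set RigidSpace} (hA : IsRetractOf A) : IsClosed A := by
  obtain ⟨r, hr, hrA⟩ := hA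
  by_cases hid : (fun x => (r x : RigidSpace)) = id
  · have : A = univ := eq_univ_of_forall fun x => by
      have := congrFun hid x
      simp only [id] at this
      exact this ▸ (r x).2
    exact this ▸ isClosed_univ
  · obtain ⟨c, hc⟩ := stronglyRigid _ (continuous_subtype_val.comp hr) hid
    refine Set.Subsingleton.isClosed fun a ha b hb => ?_
    have h1 := hc a
    have h2 := hc b
    simp only [Function.comp] at h1 h2
    rw [hrA ⟨a, ha⟩] at h1
    rw [hrA ⟨b, hb⟩] at h2
    exact h1.trans h2.symm

end RigidSpace

/-! ### Metrizable refinement and compact sets -/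

namespace RigidSpace

/-- An injective enumeration of the points. -/
noncomputable def code : RigidSpace → ℕ := (exists_injective_nat RigidSpace).choose

theorem code_injective : Function.Injective code := (exists_injective_nat RigidSpace).choose_spec

open scoped Classical in
/-- The distance to the hub in the metrizable refinement. -/
noncomputable def weight (x : RigidSpace) : ℝ :=
  if x = hub then 0 else if x ∈ hubSeq then 1 / ((code x : ℝ) + 1) else 1

theorem weight_hub : weight hub = 0 := by simp [weight]

theorem weight_pos {x : RigidSpace} (hx : x ≠ hub) : 0 < weight x := by
  rw [weight, if_neg hx]
  split_ifs <;> positivity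

theorem weight_nonneg (x : RigidSpace) : 0 ≤ weight x := by
  by_cases hx : x = hub
  · rw [hx, weight_hub]
  · exact (weight_pos hx).le

/-- The space with the metrizable topology in which the points other than the hub are isolated. -/
@[ext]
structure Refined : Type where
  point : RigidSpace

open scoped Classical in
noncomputable instance : MetricSpace Refined where
  dist x y := if x = y then 0 else max (weight x.point) (weight y.point)
  dist_self x := if_pos rfl
  dist_comm x y := by simp only [eq_comm, max_comm]
  dist_triangle x y z := by
    have := weight_nonneg x.point
    have := weight_nonneg y.point
    have := weight_nonneg z.point
    by_cases h1 : x = z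
    · simp only [h1, if_true]; split_ifs <;> positivity
    · by_cases h2 : x = y
      · subst h2; simp
      · by_cases h3 : y = z
        · subst h3; simp
        · simp only [h1, h2, h3, if_false]
          have := le_max_left (weight x.point) (weight y.point)
          have := le_max_right (weight y.point) (weight z.point)
          have := le_max_left (weight y.point) (weight z.point)
          exact max_le (by linarith) (by linarith)
  eq_of_dist_eq_zero := by
    intro x y h
    by_contra hne
    have h' : max (weight x.point) (weight y.point) = 0 := (if_neg hne).symm.trans h
    have key (w : RigidSpace) (hw : weight w ≤ 0) : w = hub := by
      by_contra h''; exact absurd (weight_pos h'') (not_lt.2 hw)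
    exact hne (Refined.ext ((key _ (h' ▸ le_max_left _ _)).trans (key _ (h' ▸ le_max_right _ _)).symm))

/-- The identity map from the metrizable refinement. -/
def fromRefined : Refined ≃ RigidSpace := ⟨Refined.point, Refined.mk, fun _ => rfl, fun _ => rfl⟩

theorem dist_of_ne {x y : RigidSpace} (h : x ≠ y) :
    dist (Refined.mk x) (Refined.mk y) = max (weight x) (weight y) := by
  classical
  exact if_neg fun h' => h (congrArg Refined.point h')

theorem isOpen_refined_iff {U : Set Refined} :
    IsOpen U ↔ (⟨hub⟩ ∈ U → (hubSeq \ Refined.mk ⁻¹' U).Finite) := by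
  rw [Metric.isOpen_iff]
  constructor
  · intro h hU
    obtain ⟨ε, hε, hball⟩ := h _ hU
    obtain ⟨N, hN⟩ := exists_nat_one_div_lt hε
    refine Set.Finite.subset ((Set.finite_Iio N).preimage code_injective.injOn) ?_
    rintro p ⟨hp, hpU⟩
    by_contra hpN
    refine hpU (hball (?_ : dist (Refined.mk p) (Refined.mk hub) < ε))
    have hne : p ≠ hub := by rintro rfl; exact hpU hU
    rw [dist_of_ne hne, weight_hub, max_eq_left (weight_nonneg p), weight, if_neg hne, if_pos hp]
    refine lt_of_le_of_lt (one_div_le_one_div_of_le (by positivity) ?_) hN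
    have : N ≤ code p := by simpa using hpN
    gcongr
  · rintro h ⟨x⟩ hx
    by_cases hxh : x = hub
    · subst hxh
      obtain ⟨N, hN⟩ := ((h hx).image code).bddAbove
      refine ⟨1 / ((N : ℝ) + 1), by positivity, ?_⟩
      rintro ⟨p⟩ hp
      by_contra hpU
      have hne : p ≠ hub := by rintro rfl; exact hpU hx
      rw [Metric.mem_ball, dist_of_ne hne] at hp
      have hp' : weight p < 1 / ((N : ℝ) + 1) := lt_of_le_of_lt (le_max_left _ _) hp
      rw [weight, if_neg hne] at hp'
      split_ifs at hp' with hps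
      · have hle : code p ≤ N := hN (mem_image_of_mem _ ⟨hps, hpU⟩)
        refine absurd hp' (not_lt.2 (one_div_le_one_div_of_le (by positivity) ?_))
        gcongr
      · refine absurd hp' (not_lt.2 ?_)
        rw [div_le_one (by positivity)]
        have : (0 : ℝ) ≤ N := by positivity
        linarith
    · refine ⟨weight x, weight_pos hxh, ?_⟩
      rintro ⟨p⟩ hp
      by_contra hpU
      have hne : p ≠ x := by rintro rfl; exact hpU hx
      rw [Metric.mem_ball, dist_of_ne hne] at hp
      exact absurd (lt_of_le_of_lt (le_max_right _ _) hp) (lt_irrefl _)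

theorem continuous_fromRefined : Continuous fromRefined :=
  ⟨fun _ hU => isOpen_refined_iff.2 fun h => negligible_hub.1 (hU hub h)⟩

/-- A compact set contains almost no points outside the convergent sequence. -/
theorem finite_of_isCompact {K E : Set RigidSpace} (hK : IsCompact K) (hEK : E ⊆ K)
    (hE : hub ∈ K → Disjoint hubSeq E) : E.Finite := by
  by_contra hinf
  have hinf' : (E \ {hub}).Infinite := Set.Infinite.sdiff hinf (finite_singleton hub)
  obtain ⟨F, hF, hFinf, hthin⟩ := grids.exists_infinite_thin_subset hinf'
  -- The complements of these closed sets cover `K`, and each contains at most one point of `F`, so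
  -- no finite subfamily suffices. Adding the hub when it lies outside `K` secures closedness there.
  have hclosed : ∀ e ∈ F, IsClosed (F \ {e} ∪ {w | w = hub ∧ hub ∉ K}) := by
    intro e _
    refine isClosed_of_thin (fun w _ => BlockSystem.Small.union ⟨1, fun k _ t => ?_⟩
      (BlockSystem.small_of_finite ((finite_singleton hub).subset fun w hw => hw.1))) fun h => ?_
    · rw [pow_one]
      exact (grids.count_mono k t sdiff_subset).trans (hthin k t)
    · have hK' : hub ∈ K := by
        by_contra h'
        exact h (Or.inr ⟨rfl, h'⟩)
      refine finite_empty.subset ?_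
      rintro p ⟨hp, hp' | hp'⟩
      · exact Set.disjoint_left.1 (hE hK') hp (hF hp'.1).1
      · exact hp'.2 hK'
  obtain ⟨t, ht⟩ := hK.elim_finite_subcover
    (fun e : F => (F \ {(e : RigidSpace)} ∪ {w | w = hub ∧ hub ∉ K})ᶜ)
    (fun e => (hclosed e e.2).isOpen_compl) (fun p hp => by
      have hph : ¬ (p = hub ∧ hub ∉ K) := fun h => h.2 (h.1 ▸ hp)
      simp only [mem_iUnion, mem_compl_iff, mem_union, not_or]
      by_cases hpF : p ∈ F
      · exact ⟨⟨p, hpF⟩, fun h => h.2 rfl, hph⟩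
      · obtain ⟨e, he⟩ := hFinf.nonempty
        exact ⟨⟨e, he⟩, fun h => hpF h.1, hph⟩)
  refine hFinf ((t.finite_toSet.image Subtype.val).subset fun p hp => ?_)
  have := ht (hEK (hF hp).1)
  simp only [mem_iUnion] at this
  obtain ⟨e, he, hpe⟩ := this
  refine ⟨e, he, ?_⟩
  by_contra hne
  exact hpe (Or.inl ⟨hp, fun h => hne h.symm⟩)

theorem isCompact_preimage_fromRefined {K : Set RigidSpace} (hK : IsCompact K) :
    IsCompact (fromRefined ⁻¹' K) := by
  by_cases h : hub ∈ K
  · refine isCompact_of_finite_subcover fun {ι} U hU hKU => ?_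
    obtain ⟨i, hi⟩ := mem_iUnion.1 (hKU (show Refined.mk hub ∈ fromRefined ⁻¹' K from h))
    have hfin : (fromRefined ⁻¹' K \ U i).Finite := by
      have h1 : (K \ hubSeq).Finite := finite_of_isCompact hK sdiff_subset fun _ =>
        disjoint_sdiff_right
      have h2 := isOpen_refined_iff.1 (hU i) hi
      refine ((h1.union h2).image Refined.mk).subset ?_
      rintro ⟨p⟩ hp
      refine ⟨p, ?_, rfl⟩
      by_cases hps : p ∈ hubSeq
      · exact Or.inr ⟨hps, hp.2⟩
      · exact Or.inl ⟨hp.1, hps⟩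
    obtain ⟨t, ht⟩ := hfin.isCompact.elim_finite_subcover U hU (fun p hp => hKU hp.1)
    classical
    refine ⟨insert i t, fun p hp => ?_⟩
    by_cases hpi : p ∈ U i
    · exact mem_biUnion (Finset.mem_insert_self _ _) hpi
    · exact biUnion_subset_biUnion_left (fun _ => Finset.mem_insert_of_mem) (ht ⟨hp, hpi⟩)
  · exact ((finite_of_isCompact hK Subset.rfl fun h' => absurd h' h).preimage
      fromRefined.injective.injOn).isCompact

theorem continuous_toRefined {K : Type v} [TopologicalSpace K] [CompactSpace K] [T2Space K]
    {g : K → RigidSpace} (hg : Continuous g) : Continuous fun k => fromRefined.symm (g k) := by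
  have hfib (E : Set RigidSpace) (hE : E.Finite) : IsClosed (g ⁻¹' E) := hE.isClosed.preimage hg
  rw [continuous_iff_continuousAt]
  intro k
  rw [ContinuousAt, tendsto_nhds]
  intro U hU hkU
  by_cases hk : g k = hub
  · have hfin : (range g \ Refined.mk ⁻¹' U).Finite := by
      have h1 : (range g \ hubSeq).Finite := finite_of_isCompact (isCompact_range hg)
        sdiff_subset fun _ => disjoint_sdiff_right
      have h2 := isOpen_refined_iff.1 hU (by rw [hk] at hkU; exact hkU)
      refine (h1.union h2).subset fun p hp => ?_
      by_cases hps : p ∈ hubSeq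
      · exact Or.inr ⟨hps, hp.2⟩
      · exact Or.inl ⟨hp.1, hps⟩
    filter_upwards [(hfib _ hfin).isOpen_compl.mem_nhds fun h => h.2 hkU] with k' hk'
    by_contra h
    exact hk' ⟨mem_range_self k', h⟩
  -- On a compact neighborhood avoiding the fiber of the hub, `g` has finitely many values, each
  -- with closed fiber, so `g` is locally constant at `k`.
  · obtain ⟨L, hLk, hLhub, hL⟩ := local_compact_nhds
      ((hfib _ (finite_singleton hub)).isOpen_compl.mem_nhds hk)
    have hfin : (g '' L).Finite := finite_of_isCompact (hL.image hg) Subset.rfl fun h => by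
      obtain ⟨k', hk', h⟩ := h
      exact absurd h (hLhub hk')
    filter_upwards [hLk, (hfib _ (hfin.sdiff (t := {g k}))).isOpen_compl.mem_nhds
      fun h => h.2 rfl] with k' hk'L hk'
    have : g k' = g k := by
      by_contra h
      exact hk' ⟨mem_image_of_mem g hk'L, h⟩
    rw [mem_preimage, this]
    exact hkU

theorem k2Metrizable : K2Metrizable.{0, v} RigidSpace :=
  ⟨Refined, inferInstance, fromRefined, inferInstance,
    ⟨continuous_fromRefined, fun _ => isCompact_preimage_fromRefined⟩,
    fun _ _ _ _ _ => continuous_toRefined⟩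

theorem kDeltaHausdorff : KDeltaHausdorff.{0, v} RigidSpace := by
  intro K _ _ _ f hf
  have h1 := continuous_toRefined (continuous_fst.comp hf)
  have h2 := continuous_toRefined (continuous_snd.comp hf)
  have : f ⁻¹' diagonal RigidSpace =
      {k | fromRefined.symm (f k).1 = fromRefined.symm (f k).2} := by
    ext k; simp
  exact this ▸ isClosed_eq h1 h2

/-- A convergent sequence is a continuous map on the compact Hausdorff space `OnePoint ℕ`, so it
converges in the metrizable refinement too. -/
theorem usSpace : USSpace RigidSpace := by
  have key : ∀ (s : ℕ → RigidSpace) (a : RigidSpace), Tendsto s atTop (𝓝 a) →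
      Tendsto (fun n => fromRefined.symm (s n)) atTop (𝓝 (fromRefined.symm a)) := by
    intro s a hs
    have hg : Continuous (fun p : OnePoint ℕ => p.elim a s) := by
      rw [OnePoint.continuous_iff_from_nat]
      simpa using hs
    have := (OnePoint.continuous_iff_from_nat _).1 (continuous_toRefined hg)
    simpa using this
  intro s a b ha hb
  exact fromRefined.symm.injective (tendsto_nhds_unique (key s a ha) (key s b hb))

/-! ### A compact metrizable subspace that is not closed -/

/-- The convergent sequence together with its limit. -/
def hubSet : Set RigidSpace := insert hub hubSeq

theorem isCompact_hubSet : IsCompact hubSet := by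
  refine isCompact_of_finite_subcover fun {ι} U hU hKU => ?_
  obtain ⟨i, hi⟩ := mem_iUnion.1 (hKU (mem_insert _ _))
  have hfin : (hubSet \ U i).Finite := by
    refine (negligible_hub.1 (hU i hub hi)).subset ?_
    rintro p ⟨rfl | hp, hpi⟩
    · exact absurd hi hpi
    · exact ⟨hp, hpi⟩
  obtain ⟨t, ht⟩ := hfin.isCompact.elim_finite_subcover U hU (fun p hp => hKU hp.1)
  classical
  refine ⟨insert i t, fun p hp => ?_⟩
  by_cases hpi : p ∈ U i
  · exact mem_biUnion (Finset.mem_insert_self _ _) hpi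
  · exact biUnion_subset_biUnion_left (fun _ => Finset.mem_insert_of_mem) (ht ⟨hp, hpi⟩)

theorem metrizableSpace_hubSet : TopologicalSpace.MetrizableSpace hubSet := by
  have hcont : Continuous fun p : hubSet => fromRefined.symm p := by
    rw [continuous_iff_continuousAt]
    intro p
    rw [ContinuousAt, tendsto_nhds]
    intro U hU hpU
    obtain ⟨p, rfl | hp⟩ := p
    · have hfin : (hubSeq \ Refined.mk ⁻¹' U).Finite := isOpen_refined_iff.1 hU hpU
      filter_upwards [(hfin.isClosed.isOpen_compl.preimage continuous_subtype_val).mem_nhds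
        (show (⟨hub, mem_insert _ _⟩ : hubSet) ∈ _ from fun h => h.2 hpU)] with q hq
      obtain ⟨q, rfl | hqs⟩ := q
      · exact hpU
      · by_contra h
        exact hq ⟨hqs, h⟩
    · obtain ⟨n, j, rfl⟩ := hp
      -- The cone over a point of `hubSeq` meets `hubSet` in that point only.
      filter_upwards [((isOpen_cone [(n, 0, j)]).preimage continuous_subtype_val).mem_nhds
        (node_mem_cone.2 List.suffix_rfl)] with q hq
      obtain ⟨l, hl, hql⟩ := hq
      obtain ⟨q, rfl | ⟨m, i, rfl⟩⟩ := q
      · simp at hql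
      · simp only [node.injEq] at hql
        subst hql
        rw [List.suffix_cons_iff] at hl
        rcases hl with hl | hl
        · have h0 : ((n, 0, j) : ℕ × ℕ × ℕ) = (m, 0, i) := by simpa using hl
          rw [Prod.mk.injEq, Prod.mk.injEq] at h0
          obtain ⟨rfl, -, rfl⟩ := h0
          exact hpU
        · simp at hl
  have hind : IsInducing fun p : hubSet => fromRefined.symm p :=
    IsInducing.of_comp hcont continuous_fromRefined IsInducing.subtypeVal
  exact (IsEmbedding.mk hind (fromRefined.symm.injective.comp Subtype.val_injective)).metrizableSpace

/-- The root lies in the closure: `hubSeq` contains column 0 of every grid of the root. -/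
theorem not_isClosed_hubSet : ¬ IsClosed hubSet := by
  intro h
  have hroot : node [] ∈ hubSetᶜ := by
    rintro (h | ⟨n, j, h⟩) <;> simp at h
  have := (h.isOpen_compl (node []) hroot).1
  rw [compl_compl] at this
  refine BlockSystem.not_small_of_blocks (fun m => ⟨2 * gridCode [] m + 1, ?_, owner_node _ _, 0,
    card_column (blockSize_pos _), fun p hp => ?_⟩) this
  · have := le_gridCode [] m
    omega
  · obtain ⟨-, j, -, rfl⟩ := mem_gridBlock_column.1 hp
    exact Or.inr ⟨m, j, by simp⟩

end RigidSpace

theorem theorem1p5 :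
    ∃ (X : Type) (_ : TopologicalSpace X),
      Countable X ∧
      StronglyRigid X ∧
      K2Metrizable.{0, v} X ∧
      SemiHausdorff X ∧
      Brown X ∧
      (∃ A : Set X, IsCompact A ∧ TopologicalSpace.MetrizableSpace A ∧ ¬ IsClosed A) ∧
      (∀ A : Set X, IsRetractOf A → IsClosed A) ∧
      KDeltaHausdorff.{0, v} X ∧
      USSpace X :=
  ⟨RigidSpace, inferInstance, inferInstance, RigidSpace.stronglyRigid, RigidSpace.k2Metrizable,
    RigidSpace.semiHausdorff, RigidSpace.brown,
    ⟨RigidSpace.hubSet, RigidSpace.isCompact_hubSet, RigidSpace.metrizableSpace_hubSet,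
      RigidSpace.not_isClosed_hubSet⟩,
    fun _ => RigidSpace.isClosed_of_isRetractOf, RigidSpace.kDeltaHausdorff, RigidSpace.usSpace⟩
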